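/- An oriented graph is a finite directed graph without loops and with at most one arc between any two vertices. For an oriented graph $D$ with vertex set $V$, let $e(D)$ be its number of arcs, and for (not necessarily disjoint) $A,B\subseteq V$ let $e(A,B)$ be the number of arcs $\vec{xy}$ of $D$ with $x\in A$ and $y\in B$. For $\nu\in(0,1)$ put $$\mathrm{bias}_\nu(D)=\max\{e(A,B) : A,B\subseteq V,\ e(B,A)\le \nu\, e(A,B)\}.$$ **Theorem.** Let $H$ be an oriented graph on $h$ vertices. There is a real number $\beta=\beta(H)$ with $0<\beta<\frac12$ such that for every $\nu\in(0,1)$ there are a real $\varepsilon>0$ and an integer $N$ with the following property: every oriented graph $D$ on $n\ge N$ vertices with $e(D)\ge \beta n^2$ and $\mathrm{bias}_\nu(D)\le \varepsilon\, e(D)$ contains $H$ as a (not necessarily induced) subgraph. If moreover the underlying undirected graph of $H$ is bipartite, then $\beta$ can be taken arbitrarily small: for every $\beta\in(0,\frac12)$ and every $\nu\in(0,1)$ there are $\varepsilon>0$ and an integer $N$ such that every oriented graph $D$ on $n\ge N$ vertices with $e(D)\ge\beta n^2$ and $\mathrm{bias}_\nu(D)\le\varepsilon\, e(D)$ contains $H$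 as a subgraph. -/

import Mathlib

universe u v

namespace OrientedBias

/-- An oriented graph: no loops, and no two arcs in opposite directions between two vertices. -/
def IsOriented {V : Type u} (D : Digraph V) : Prop :=
  ∀ x y : V, D.Adj x y → ¬ D.Adj y x

open Classical in
/-- `e(A, B)`: the number of arcs `xy` with `x ∈ A` and `y ∈ B`
(`A` and `B` need not be disjoint). -/
noncomputable def arcsBetween {V : Type u} (D : Digraph V) (A B : Finset V) : ℕ :=
  ((A ×ˢ B).filter fun p => D.Adj p.1 p.2).card

/-- `e(D)`: the number of arcs of `D`. -/
noncomputable def numArcs {V : Type u} [Fintype V] (D : Digraph V) : ℕ :=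
  arcsBetween D Finset.univ Finset.univ

open Classical in
/-- `bias_γ(D)`: the maximum of `e(A, B)` over all `A, B ⊆ V` with `e(B, A) ≤ γ e(A, B)`.
The pair `A = B = ∅` always qualifies, so this is a maximum over a non-empty finite family. -/
noncomputable def bias {V : Type u} [Fintype V] (γ : ℝ) (D : Digraph V) : ℕ :=
  (Finset.univ.filter fun P : Finset V × Finset V =>
    (arcsBetween D P.2 P.1 : ℝ) ≤ γ * (arcsBetween D P.1 P.2 : ℝ)).sup
      fun P => arcsBetween D P.1 P.2

/-- `D` contains (a copy of) `H` as a subgraph, not necessarily induced. -/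
def ContainsCopy {W : Type u} {V : Type v} (H : Digraph W) (D : Digraph V) : Prop :=
  ∃ f : W ↪ V, ∀ x y : W, H.Adj x y → D.Adj (f x) (f y)

end OrientedBias

/-! Colour `H` properly with `k` colours. If `D` has at least `β n²` arcs and `1 - 2β < 1 / k.choose
2`, a union bound over pairs of coordinates gives a positive density `t₀` of `k`-tuples with
pairwise linked entries. A density increment argument turns this into `k` linear-sized sets in which
any two large subsets of different sets have linked density at least `t₀ / 2`
(`exists_isLowerRegular`).

Small bias makes this two-directional: between large `X` and `Y`, one direction has density at least
`t₀ / 4`, and since its arc count exceeds the bias, the other has at least a `ν` fraction of it. So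
every orientation is dense between large subsets, and `H` embeds greedily with each vertex placed in
the set of its colour (`containsCopy_of_dense`).

With `k = h`, `β` has to be close to `1/2`; with `k = 2` every `β > 0` works. -/

namespace OrientedBias

/-! ### Density increment on boxes -/

section Boxes

variable {ι : Type*} {V : Type*} [Fintype ι]

/-- The number of points of the box `∏ i, A i`. -/
def boxVol (A : ι → Finset V) : ℕ := ∏ i, (A i).card

lemma card_pos_of_boxVol_pos {A : ι → Finset V} (hA : 0 < boxVol A) (i : ι) :
    0 < (A i).card :=
  Nat.pos_of_ne_zero fun h => hA.ne' (Finset.prod_eq_zero (Finset.mem_univ i) h)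

variable [DecidableEq ι]

open Classical in
/-- The number of points of the box `∏ i, A i` that satisfy `T`. -/
noncomputable def boxCount (T : (ι → V) → Prop) (A : ι → Finset V) : ℕ :=
  ((Fintype.piFinset A).filter T).card

lemma boxCount_le_boxVol (T : (ι → V) → Prop) (A : ι → Finset V) :
    boxCount T A ≤ boxVol A := by
  classical
  unfold boxCount boxVol
  rw [← Fintype.card_piFinset]
  exact Finset.card_filter_le _ _

lemma boxCount_mono {T T' : (ι → V) → Prop} (h : ∀ x, T x → T' x) (A : ι → Finset V) :
    boxCount T A ≤ boxCount T' A := by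
  classical
  exact Finset.card_le_card (Finset.monotone_filter_right _ fun x _ hx => h x hx)

open Classical in
lemma boxCount_split (T : (ι → V) → Prop) (A : ι → Finset V) (i : ι) {X : Finset V}
    (hX : X ⊆ A i) :
    boxCount T A =
      boxCount T (Function.update A i X) + boxCount T (Function.update A i (A i \ X)) := by
  unfold boxCount
  rw [← Finset.card_filter_add_card_filter_not (s := (Fintype.piFinset A).filter T)
    (fun x => x i ∈ X)]
  congr 2
  · ext x
    simp only [Finset.mem_filter, Fintype.mem_piFinset]
    constructor
    · rintro ⟨⟨h1, h2⟩, h3⟩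
      refine ⟨fun l => ?_, h2⟩
      by_cases hl : l = i
      · subst hl; simpa using h3
      · simpa [hl] using h1 l
    · rintro ⟨h1, h2⟩
      have h3 : x i ∈ X := by simpa using h1 i
      refine ⟨⟨fun l => ?_, h2⟩, h3⟩
      by_cases hl : l = i
      · subst hl; exact hX h3
      · simpa [hl] using h1 l
  · ext x
    simp only [Finset.mem_filter, Fintype.mem_piFinset]
    constructor
    · rintro ⟨⟨h1, h2⟩, h3⟩
      refine ⟨fun l => ?_, h2⟩
      by_cases hl : l = i
      · subst hl; simpa using ⟨h1 l, h3⟩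
      · simpa [hl] using h1 l
    · rintro ⟨h1, h2⟩
      have h3 : x i ∈ A i ∧ x i ∉ X := by simpa using h1 i
      refine ⟨⟨fun l => ?_, h2⟩, h3.2⟩
      by_cases hl : l = i
      · subst hl; exact h3.1
      · simpa [hl] using h1 l

lemma boxVol_update_mul (A : ι → Finset V) (i : ι) (X : Finset V) :
    boxVol (Function.update A i X) * (A i).card = X.card * boxVol A := by
  unfold boxVol
  rw [← Finset.mul_prod_erase _ _ (Finset.mem_univ i),
    ← Finset.mul_prod_erase _ (fun l => (A l).card) (Finset.mem_univ i)]
  have : ∏ l ∈ Finset.univ.erase i, (Function.update A i X l).card =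
      ∏ l ∈ Finset.univ.erase i, (A l).card :=
    Finset.prod_congr rfl fun l hl => by rw [Function.update_of_ne (Finset.ne_of_mem_erase hl)]
  rw [this, Function.update_self]
  ring

lemma boxVol_update₂_mul (A : ι → Finset V) {i j : ι} (hij : i ≠ j) (X Y : Finset V) :
    boxVol (Function.update (Function.update A i X) j Y) * ((A i).card * (A j).card) =
      (X.card * Y.card) * boxVol A := by
  have h1 := boxVol_update_mul (Function.update A i X) j Y
  have h2 := boxVol_update_mul A i X
  rw [Function.update_of_ne hij.symm] at h1
  calc _ = (boxVol (Function.update (Function.update A i X) j Y) * (A j).card) * (A i).card := by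
        ring
    _ = Y.card * (boxVol (Function.update A i X) * (A i).card) := by rw [h1]; ring
    _ = _ := by rw [h2]; ring

open Classical in
lemma boxVol_split (A : ι → Finset V) (i : ι) {X : Finset V} (hX : X ⊆ A i) :
    boxVol A = boxVol (Function.update A i X) + boxVol (Function.update A i (A i \ X)) := by
  have key : ∀ B : ι → Finset V, boxVol B = boxCount (fun _ => True) B := fun B => by
    simp [boxVol, boxCount]
  simp only [key]
  exact boxCount_split _ A i hX

-- Fibring over the pair of coordinates `(i, j)`, each fibre is a box of volume `boxVol A / (|A i|
-- |A j|)`. The identity is cleared of denominators.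
open Classical in
lemma boxCount_pair_mul (A : ι → Finset V) {i j : ι} (hij : i ≠ j) (R : V → V → Prop) :
    boxCount (fun x => R (x i) (x j)) A * ((A i).card * (A j).card) =
      ((A i ×ˢ A j).filter fun p => R p.1 p.2).card * boxVol A := by
  unfold boxCount
  rw [Finset.card_eq_sum_card_fiberwise (f := fun x : ι → V => (x i, x j))
    (t := (A i ×ˢ A j).filter fun p => R p.1 p.2), Finset.sum_mul]
  · refine (Finset.sum_congr rfl ?_).trans (Finset.sum_const (boxVol A))
    rintro ⟨a, b⟩ hab
    simp only [Finset.mem_filter, Finset.mem_product] at hab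
    have hfib : (((Fintype.piFinset A).filter fun x => R (x i) (x j)).filter
        fun x => (x i, x j) = (a, b)) =
        Fintype.piFinset (Function.update (Function.update A i {a}) j {b}) := by
      ext x
      simp only [Finset.mem_filter, Fintype.mem_piFinset, Prod.mk.injEq]
      constructor
      · rintro ⟨⟨h1, -⟩, rfl, rfl⟩ l
        by_cases hj : l = j
        · subst hj; simp
        · by_cases hi : l = i
          · subst hi; simp [hj]
          · simpa [hi, hj] using h1 l
      · intro h
        have hi : x i = a := by simpa [hij] using h i
        have hj : x j = b := by simpa using h j
        refine ⟨⟨fun l => ?_, by rw [hi, hj]; exact hab.2⟩, hi, hj⟩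
        by_cases hlj : l = j
        · subst hlj; rw [hj]; exact hab.1.2
        · by_cases hli : l = i
          · subst hli; rw [hi]; exact hab.1.1
          · simpa [hli, hlj] using h l
    rw [hfib, Fintype.card_piFinset]
    have := boxVol_update₂_mul A hij {a} {b}
    simpa [boxVol] using this
  · intro x hx
    simp only [Finset.coe_filter, Set.mem_ofPred_eq, Fintype.mem_piFinset] at hx
    simp [hx.1 i, hx.1 j, hx.2]

-- The sparse box on `X`, `Y` takes up at least a `δ ^ 2` share of `A`, so its deficit must be made
-- up on the rest of `A`. The rest is a union of two boxes, one of which is therefore denser than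
-- `A` and not too small.
open Classical in
lemma exists_density_increment {T : (ι → V) → Prop} {A : ι → Finset V} {t₀ τ δ : ℝ}
    (ht₀ : 0 < t₀) (hτ : t₀ ≤ τ) (hδ : 0 < δ) (hA : 0 < boxVol A)
    (hT : τ * boxVol A ≤ boxCount T A) {i j : ι} (hij : i ≠ j) {X Y : Finset V}
    (hX : X ⊆ A i) (hY : Y ⊆ A j) (hXc : δ * (A i).card ≤ X.card)
    (hYc : δ * (A j).card ≤ Y.card)
    (hXY : (boxCount T (Function.update (Function.update A i X) j Y) : ℝ) ≤
      t₀ / 2 * boxVol (Function.update (Function.update A i X) j Y)) :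
    ∃ B : ι → Finset V, t₀ * δ ^ 2 / 16 * boxVol A ≤ boxVol B ∧
      (1 + δ ^ 2 / 8) * τ * boxVol B ≤ boxCount T B := by
  by_contra! hcon
  set B₁ := Function.update (Function.update A i X) j Y with hB₁
  set B₂ := Function.update (Function.update A i X) j (A j \ Y) with hB₂
  set B₃ := Function.update A i (A i \ X) with hB₃
  have hY' : Y ⊆ Function.update A i X j := by rwa [Function.update_of_ne hij.symm]
  have hN : (boxCount T A : ℝ) = boxCount T B₁ + boxCount T B₂ + boxCount T B₃ := by
    have h1 := boxCount_split T A i hX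
    have h2 := boxCount_split T (Function.update A i X) j hY'
    rw [Function.update_of_ne hij.symm] at h2
    rw [h1, h2]; push_cast; rfl
  have hP : (boxVol A : ℝ) = boxVol B₁ + boxVol B₂ + boxVol B₃ := by
    have h1 := boxVol_split A i hX
    have h2 := boxVol_split (Function.update A i X) j hY'
    rw [Function.update_of_ne hij.symm] at h2
    rw [h1, h2]; push_cast; rfl
  have hAi : (0 : ℝ) < (A i).card := by exact_mod_cast card_pos_of_boxVol_pos hA i
  have hAj : (0 : ℝ) < (A j).card := by exact_mod_cast card_pos_of_boxVol_pos hA j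
  have hPpos : (0 : ℝ) < boxVol A := by exact_mod_cast hA
  have hτpos : 0 < τ := ht₀.trans_le hτ
  have hP1 : δ ^ 2 * boxVol A ≤ boxVol B₁ := by
    have h : (boxVol B₁ : ℝ) * ((A i).card * (A j).card) = (X.card * Y.card) * boxVol A := by
      exact_mod_cast boxVol_update₂_mul A hij X Y
    have h2 : (δ * (A i).card) * (δ * (A j).card) ≤ (X.card : ℝ) * Y.card :=
      mul_le_mul hXc hYc (by positivity) (by positivity)
    refine le_of_mul_le_mul_right ?_ (mul_pos hAi hAj)
    rw [h]
    calc _ = (δ * (A i).card) * (δ * (A j).card) * boxVol A := by ring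
      _ ≤ _ := mul_le_mul_of_nonneg_right h2 hPpos.le
  -- A box too small for `hcon` contributes at most its volume, which the additive term absorbs.
  have hsmall : ∀ B : ι → Finset V, (boxCount T B : ℝ) ≤
      (1 + δ ^ 2 / 8) * τ * boxVol B + t₀ * δ ^ 2 / 16 * boxVol A := by
    intro B
    by_cases hB : t₀ * δ ^ 2 / 16 * boxVol A ≤ boxVol B
    · have := (hcon B hB).le
      have : (0 : ℝ) ≤ t₀ * δ ^ 2 / 16 * boxVol A := by positivity
      linarith
    · have h1 : (boxCount T B : ℝ) ≤ boxVol B := by exact_mod_cast boxCount_le_boxVol T B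
      have : (0 : ℝ) ≤ (1 + δ ^ 2 / 8) * τ * boxVol B := by positivity
      linarith
  have h2 := hsmall B₂
  have h3 := hsmall B₃
  have h1 : (boxCount T B₁ : ℝ) ≤ τ / 2 * boxVol B₁ :=
    hXY.trans (mul_le_mul_of_nonneg_right (by linarith) (by positivity))
  have h4 : τ * (δ ^ 2 * boxVol A) ≤ τ * boxVol B₁ := mul_le_mul_of_nonneg_left hP1 hτpos.le
  have h5 : t₀ * (δ ^ 2 * boxVol A) ≤ τ * (δ ^ 2 * boxVol A) :=
    mul_le_mul_of_nonneg_right hτ (by positivity)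
  have h6 : 0 < τ * (δ ^ 2 * boxVol A) := by positivity
  have h7 : 0 ≤ τ * (δ ^ 2 * boxVol B₁) := by positivity
  have h8 : (boxVol B₂ : ℝ) + boxVol B₃ = boxVol A - boxVol B₁ := by linarith
  have h9 : (1 + δ ^ 2 / 8) * τ * boxVol B₂ + (1 + δ ^ 2 / 8) * τ * boxVol B₃ =
      (1 + δ ^ 2 / 8) * τ * (boxVol A - boxVol B₁) := by rw [← h8]; ring
  -- The deficit on `B₁` is at least `τ δ² / 2` times `boxVol A`; the gains on `B₂` and `B₃`,
  -- including both additive errors, total at most `τ δ² / 4` times it.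
  nlinarith

/-- A box in which any two large subsets of two different sides span many pairs
related by `R`. -/
def IsLowerRegular (R : V → V → Prop) (κ δ : ℝ) (A : ι → Finset V) : Prop :=
  ∀ i j, i ≠ j → ∀ X ⊆ A i, ∀ Y ⊆ A j, δ * (A i).card ≤ X.card → δ * (A j).card ≤ Y.card →
    κ * (X.card * Y.card) ≤ (open Classical in
      ((X ×ˢ Y).filter fun p => R p.1 p.2).card : ℝ)

/-- A failure of regularity allows a density increment by the factor `1 + δ ^ 2 / 8`. Densities
never exceed 1, so `hm` bounds the number of increments by `m`. -/
lemma exists_isLowerRegular_of_pow {R : V → V → Prop} {t₀ δ : ℝ} (ht₀ : 0 < t₀) (ht₁ : t₀ ≤ 1)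
    (hδ : 0 < δ) (hδ₁ : δ ≤ 1) (m : ℕ) (A : ι → Finset V) (τ : ℝ) (hτ : t₀ ≤ τ)
    (hA : 0 < boxVol A)
    (hT : τ * boxVol A ≤ boxCount (fun x : ι → V => ∀ i j, i ≠ j → R (x i) (x j)) A)
    (hm : 1 < (1 + δ ^ 2 / 8) ^ m * τ) :
    ∃ B : ι → Finset V, (t₀ * δ ^ 2 / 16) ^ m * boxVol A ≤ boxVol B ∧
      IsLowerRegular R (t₀ / 2) δ B := by
  classical
  induction m generalizing A τ with
  | zero =>
    have h1 : (boxCount (fun x : ι → V => ∀ i j, i ≠ j → R (x i) (x j)) A : ℝ) ≤ boxVol A := by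
      exact_mod_cast boxCount_le_boxVol _ A
    have h2 : (0 : ℝ) < boxVol A := by exact_mod_cast hA
    rw [pow_zero, one_mul] at hm
    nlinarith
  | succ m ih =>
    have hδ2 : δ ^ 2 ≤ 1 := pow_le_one₀ hδ.le hδ₁
    have hη : t₀ * δ ^ 2 / 16 ≤ 1 := by nlinarith [sq_nonneg δ]
    by_cases hreg : IsLowerRegular R (t₀ / 2) δ A
    · refine ⟨A, ?_, hreg⟩
      exact mul_le_of_le_one_left (by positivity) (pow_le_one₀ (by positivity) hη)
    · unfold IsLowerRegular at hreg
      push Not at hreg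
      obtain ⟨i, j, hij, X, hX, Y, hY, hXc, hYc, hlt⟩ := hreg
      have hXY : (boxCount (fun x : ι → V => ∀ i j, i ≠ j → R (x i) (x j))
          (Function.update (Function.update A i X) j Y) : ℝ) ≤
          t₀ / 2 * boxVol (Function.update (Function.update A i X) j Y) := by
        set B := Function.update (Function.update A i X) j Y with hB
        have hBi : B i = X := by simp [hB, hij]
        have hBj : B j = Y := by simp [hB]
        have h1 : (boxCount (fun x : ι → V => ∀ i j, i ≠ j → R (x i) (x j)) B : ℝ) ≤
            boxCount (fun x : ι → V => R (x i) (x j)) B :=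
          Nat.cast_le.mpr (boxCount_mono (fun x hx => hx i j hij) B)
        have h2 : (boxCount (fun x : ι → V => R (x i) (x j)) B : ℝ) *
            ((X.card : ℝ) * Y.card) =
            ((X ×ˢ Y).filter fun p => R p.1 p.2).card * boxVol B := by
          have := boxCount_pair_mul B hij R
          rw [hBi, hBj] at this
          exact_mod_cast this
        have hXp : (0 : ℝ) < X.card :=
          (mul_pos hδ (by exact_mod_cast card_pos_of_boxVol_pos hA i)).trans_le hXc
        have hYp : (0 : ℝ) < Y.card :=
          (mul_pos hδ (by exact_mod_cast card_pos_of_boxVol_pos hA j)).trans_le hYc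
        refine h1.trans (le_of_mul_le_mul_right ?_ (mul_pos hXp hYp))
        rw [h2]
        calc _ ≤ t₀ / 2 * (X.card * Y.card) * (boxVol B : ℝ) :=
              mul_le_mul_of_nonneg_right hlt.le (by positivity)
          _ = _ := by ring
      obtain ⟨B, hB1, hB2⟩ :=
        exists_density_increment ht₀ hτ hδ hA hT hij hX hY hXc hYc hXY
      have hApos : (0 : ℝ) < boxVol A := by exact_mod_cast hA
      have hτp : 0 < τ := ht₀.trans_le hτ
      have hBpos : 0 < boxVol B := by
        have : (0 : ℝ) < boxVol B := lt_of_lt_of_le (by positivity) hB1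
        exact_mod_cast this
      obtain ⟨C, hC1, hC2⟩ := ih B ((1 + δ ^ 2 / 8) * τ) (by nlinarith [sq_nonneg δ]) hBpos hB2
        (by rw [← mul_assoc, ← pow_succ]; exact hm)
      refine ⟨C, le_trans ?_ hC1, hC2⟩
      rw [pow_succ, mul_assoc]
      exact mul_le_mul_of_nonneg_left hB1 (by positivity)

/-- If many points of the cube have pairwise `R`-related coordinates, then there is a lower
regular box all of whose sides are large. -/
lemma exists_isLowerRegular (ι : Type*) [Fintype ι] [DecidableEq ι] {t₀ δ : ℝ} (ht₀ : 0 < t₀)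
    (ht₁ : t₀ ≤ 1) (hδ : 0 < δ) (hδ₁ : δ ≤ 1) :
    ∃ c : ℝ, 0 < c ∧ ∀ (V : Type v) [Fintype V] [Nonempty V] (R : V → V → Prop),
      t₀ * (Fintype.card V : ℝ) ^ Fintype.card ι ≤
        boxCount (fun x : ι → V => ∀ i j, i ≠ j → R (x i) (x j)) (fun _ => Finset.univ) →
      ∃ B : ι → Finset V, (∀ i, c * Fintype.card V ≤ (B i).card) ∧
        IsLowerRegular R (t₀ / 2) δ B := by
  obtain ⟨m, hm⟩ := pow_unbounded_of_one_lt (1 / t₀) (y := 1 + δ ^ 2 / 8)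
    (by have := sq_pos_of_pos hδ; linarith)
  refine ⟨(t₀ * δ ^ 2 / 16) ^ m, by positivity, fun V _ _ R hR => ?_⟩
  have hn : 0 < Fintype.card V := Fintype.card_pos
  have hvol : boxVol (fun _ : ι => (Finset.univ : Finset V)) =
      Fintype.card V ^ Fintype.card ι := by simp [boxVol]
  obtain ⟨B, hB1, hB2⟩ := exists_isLowerRegular_of_pow (R := R) ht₀ ht₁ hδ hδ₁ m
    (fun _ : ι => (Finset.univ : Finset V)) t₀ le_rfl (by rw [hvol]; positivity)
    (by rw [hvol]; exact_mod_cast hR) (by rwa [div_lt_iff₀ ht₀] at hm)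
  refine ⟨B, fun i => ?_, hB2⟩
  -- The other sides have at most `n` elements each, so large volume forces every side to be large.
  have hBle : boxVol B ≤ (B i).card * Fintype.card V ^ (Fintype.card ι - 1) := by
    unfold boxVol
    rw [← Finset.mul_prod_erase _ _ (Finset.mem_univ i)]
    refine Nat.mul_le_mul_left _ ((Finset.prod_le_pow_card _ _ (Fintype.card V)
      fun l _ => Finset.card_le_univ _).trans_eq ?_)
    rw [Finset.card_erase_of_mem (Finset.mem_univ i), Finset.card_univ]
  have hι : Fintype.card ι - 1 + 1 = Fintype.card ι :=
    Nat.sub_add_cancel (Fintype.card_pos_iff.mpr ⟨i⟩)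
  have hnR : (0 : ℝ) < (Fintype.card V : ℝ) ^ (Fintype.card ι - 1) := by positivity
  refine le_of_mul_le_mul_right ?_ hnR
  calc _ = (t₀ * δ ^ 2 / 16) ^ m * (Fintype.card V : ℝ) ^ Fintype.card ι := by
        rw [mul_assoc, ← pow_succ', hι]
    _ ≤ boxVol B := by
        rw [hvol] at hB1; exact_mod_cast hB1
    _ ≤ _ := by exact_mod_cast hBle

end Boxes

/-! ### Counting tuples with pairwise linked entries -/

/-- Adjacency in the underlying undirected graph. -/
def Linked {V : Type*} (D : Digraph V) (x y : V) : Prop := D.Adj x y ∨ D.Adj y x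

section Counting

variable {V : Type*} (D : Digraph V)

open Classical in
lemma card_reverse (A B : Finset V) :
    ((A ×ˢ B).filter fun p => D.Adj p.2 p.1).card = arcsBetween D B A := by
  refine Finset.card_bij (fun p _ => p.swap) ?_ ?_ ?_
  · rintro ⟨a, b⟩ h
    simp only [Finset.mem_filter, Finset.mem_product, Prod.swap] at h ⊢
    tauto
  · rintro ⟨a, b⟩ - ⟨c, d⟩ - h
    simp only [Prod.swap, Prod.mk.injEq] at h ⊢
    tauto
  · rintro ⟨a, b⟩ h
    refine ⟨(b, a), ?_, rfl⟩
    simp only [Finset.mem_filter, Finset.mem_product] at h ⊢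
    tauto

open Classical in
lemma filter_linked (A B : Finset V) :
    ((A ×ˢ B).filter fun p => Linked D p.1 p.2) =
      ((A ×ˢ B).filter fun p => D.Adj p.1 p.2) ∪ ((A ×ˢ B).filter fun p => D.Adj p.2 p.1) := by
  ext p
  rw [Finset.mem_union, Finset.mem_filter, Finset.mem_filter, Finset.mem_filter, ← and_or_left]
  rfl

open Classical in
lemma card_linked_le (A B : Finset V) :
    ((A ×ˢ B).filter fun p => Linked D p.1 p.2).card ≤
      arcsBetween D A B + arcsBetween D B A := by
  rw [← card_reverse D A B, filter_linked]
  exact Finset.card_union_le _ _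

variable {D} in
open Classical in
lemma card_linked_univ [Fintype V] (hD : IsOriented D) :
    ((Finset.univ ×ˢ Finset.univ).filter fun p : V × V => Linked D p.1 p.2).card =
      2 * numArcs D := by
  rw [filter_linked, Finset.card_union_of_disjoint, card_reverse, two_mul]
  · rfl
  · exact Finset.disjoint_filter.mpr fun p _ h => hD _ _ h

variable {D} in
open Classical in
/-- Union bound over the pairs of coordinates. -/
lemma le_boxCount_linked [Fintype V] [Nonempty V] (hD : IsOriented D) (k : ℕ) {β : ℝ}
    (hβ : β * (Fintype.card V : ℝ) ^ 2 ≤ numArcs D) :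
    (1 - k.choose 2 * (1 - 2 * β)) * (Fintype.card V : ℝ) ^ k ≤
      boxCount (fun x : Fin k → V => ∀ i j, i ≠ j → Linked D (x i) (x j))
        (fun _ => Finset.univ) := by
  set U : Fin k → Finset V := fun _ => Finset.univ with hU
  set n : ℝ := (Fintype.card V : ℝ) with hn
  have hnpos : 0 < n := by rw [hn]; exact_mod_cast Fintype.card_pos
  have hvol : boxVol U = Fintype.card V ^ k := by simp [boxVol, hU]
  set pairs : Finset (Fin k × Fin k) := Finset.univ.filter fun p => p.1 < p.2 with hpairs
  have hpc : pairs.card = k.choose 2 := by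
    simpa using Fintype.card_product_filter_lt (α := Fin k)
  -- Orientedness gives `2 e(D)` linked ordered pairs, leaving at most `(1 - 2β) n²` unlinked ones,
  -- the diagonal included.
  have hpair : ∀ p ∈ pairs,
      (boxCount (fun x : Fin k → V => ¬ Linked D (x p.1) (x p.2)) U : ℝ) ≤
        (1 - 2 * β) * n ^ k := by
    intro p hp
    have hne : p.1 ≠ p.2 := (Finset.mem_filter.mp hp).2.ne
    have h1 : boxCount (fun x : Fin k → V => ¬ Linked D (x p.1) (x p.2)) U *
        (Fintype.card V * Fintype.card V) =
        ((Finset.univ ×ˢ Finset.univ).filter fun p : V × V => ¬ Linked D p.1 p.2).card *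
          Fintype.card V ^ k := by
      rw [← hvol]
      convert boxCount_pair_mul U hne (fun x y => ¬ Linked D x y) <;> exact Finset.card_univ.symm
    have h2 := Finset.card_filter_add_card_filter_not
      (s := (Finset.univ ×ˢ Finset.univ : Finset (V × V))) (fun p => Linked D p.1 p.2)
    rw [card_linked_univ hD, Finset.card_product, Finset.card_univ] at h2
    have h1' : (boxCount (fun x : Fin k → V => ¬ Linked D (x p.1) (x p.2)) U : ℝ) * (n * n) =
        ((Finset.univ ×ˢ Finset.univ).filter fun p : V × V => ¬ Linked D p.1 p.2).card *
          n ^ k := by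
      rw [hn]; exact_mod_cast h1
    have h2' : (2 : ℝ) * numArcs D +
        ((Finset.univ ×ˢ Finset.univ).filter fun p : V × V => ¬ Linked D p.1 p.2).card =
          n * n := by
      rw [hn]; exact_mod_cast h2
    refine le_of_mul_le_mul_right ?_ (mul_pos hnpos hnpos)
    rw [h1']
    calc _ ≤ (1 - 2 * β) * (n * n) * n ^ k :=
          mul_le_mul_of_nonneg_right (by nlinarith) (by positivity)
      _ = _ := by ring
  have hcover : Fintype.card V ^ k ≤
      boxCount (fun x : Fin k → V => ∀ i j, i ≠ j → Linked D (x i) (x j)) U +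
        ∑ p ∈ pairs, boxCount (fun x : Fin k → V => ¬ Linked D (x p.1) (x p.2)) U := by
    rw [← hvol, boxVol, ← Fintype.card_piFinset]
    refine (Finset.card_le_card ?_).trans ((Finset.card_union_le _ _).trans
      (Nat.add_le_add_left Finset.card_biUnion_le _))
    intro x hx
    simp only [Finset.mem_union, Finset.mem_filter, Finset.mem_biUnion, hx, true_and]
    by_contra hcon
    simp only [not_or, not_exists, not_and, not_not, Prod.forall] at hcon
    refine hcon.1 fun i j hij => ?_
    rcases lt_or_gt_of_ne hij with h | h
    · exact hcon.2 i j (Finset.mem_filter.mpr ⟨Finset.mem_univ _, h⟩)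
    · exact (hcon.2 j i (Finset.mem_filter.mpr ⟨Finset.mem_univ _, h⟩)).symm
  have hcover' : n ^ k ≤
      (boxCount (fun x : Fin k → V => ∀ i j, i ≠ j → Linked D (x i) (x j)) U : ℝ) +
        ∑ p ∈ pairs, (boxCount (fun x : Fin k → V => ¬ Linked D (x p.1) (x p.2)) U : ℝ) := by
    rw [hn]; exact_mod_cast hcover
  have hsum := Finset.sum_le_card_nsmul _ _ _ hpair
  rw [hpc, nsmul_eq_mul] at hsum
  linarith

end Counting

/-! ### Greedy embedding -/

section Embedding

variable {W : Type*} {V : Type*} {κ : Type*}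

open Classical in
/-- Few points of `X` have fewer than the expected number of `R`-neighbours in `Y`. -/
lemma card_lowDegree_lt {R : V → V → Prop} {ρ s : ℝ} (hs : 0 < s) {X Y : Finset V}
    (h : ∀ Z ⊆ X, s ≤ Z.card →
      ρ * (Z.card * Y.card) ≤ ((Z ×ˢ Y).filter fun p => R p.1 p.2).card) :
    ((X.filter fun x => ((Y.filter fun y => R x y).card : ℝ) < ρ * Y.card).card : ℝ) < s := by
  by_contra! hcon
  set Z := X.filter fun x => ((Y.filter fun y => R x y).card : ℝ) < ρ * Y.card with hZ
  have h1 := h Z (Finset.filter_subset _ _) hcon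
  have hZne : Z.Nonempty := by
    rw [← Finset.card_pos]; exact_mod_cast hs.trans_le hcon
  have h2 : ((Z ×ˢ Y).filter fun p => R p.1 p.2).card =
      ∑ x ∈ Z, (Y.filter fun y => R x y).card := by
    rw [Finset.card_filter, Finset.sum_product]
    simp only [Finset.card_filter]
  have h3 : (∑ x ∈ Z, ((Y.filter fun y => R x y).card : ℝ)) < ∑ x ∈ Z, ρ * Y.card :=
    Finset.sum_lt_sum_of_nonempty hZne fun x hx => (Finset.mem_filter.mp hx).2
  rw [Finset.sum_const, nsmul_eq_mul] at h3
  rw [h2] at h1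
  push_cast at h1
  nlinarith

-- Vertices of `H` are embedded one at a time. Each unembedded `w` keeps a candidate set `C w`,
-- which shrinks by a factor of at worst `ρ` per step and so stays above the `δ` threshold where
-- density applies. The sets `A i` may overlap; injectivity is enforced by avoiding the vertices
-- already used.
open Classical in
lemma containsCopy_of_dense [Fintype W] [Nonempty V] {H : Digraph W} (hH : IsOriented H)
    {D : Digraph V}
    (c : W → κ) (hc : ∀ x y, H.Adj x y → c x ≠ c y) (A : κ → Finset V) {ρ δ : ℝ}
    (hρ : 0 < ρ) (hρ₁ : ρ ≤ 1) (hδ : 0 < δ)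
    (hsize : ∀ i, Fintype.card W * (δ * (A i).card) + Fintype.card W <
      ρ ^ Fintype.card W * (A i).card)
    (hδρ : δ ≤ ρ ^ Fintype.card W)
    (hdense : ∀ i j, i ≠ j → ∀ X ⊆ A i, ∀ Y ⊆ A j, δ * (A i).card ≤ X.card →
      δ * (A j).card ≤ Y.card → ρ * (X.card * Y.card) ≤ arcsBetween D X Y) :
    ContainsCopy H D := by
  have hApos : ∀ i, (0 : ℝ) < (A i).card := by
    intro i
    have h1 := hsize i
    have h2 : (0 : ℝ) ≤ Fintype.card W * (δ * (A i).card) + Fintype.card W := by positivity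
    exact pos_of_mul_pos_right (h2.trans_lt h1) (by positivity)
  have key : ∀ S : Finset W, ∃ f : W → V, ∃ C : W → Finset V,
      Set.InjOn f S ∧ (∀ x ∈ S, ∀ y ∈ S, H.Adj x y → D.Adj (f x) (f y)) ∧
      (∀ w, C w ⊆ A (c w)) ∧ (∀ w, ρ ^ S.card * (A (c w)).card ≤ (C w).card) ∧
      ∀ w ∉ S, ∀ v ∈ C w, ∀ x ∈ S, (H.Adj x w → D.Adj (f x) v) ∧
        (H.Adj w x → D.Adj v (f x)) := by
    intro S
    induction S using Finset.induction_on with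
    | empty =>
      refine ⟨fun _ => Classical.arbitrary V, fun w => A (c w), by simp, by simp,
        fun _ => subset_rfl, by simp, by simp⟩
    | insert s S hs ih =>
      obtain ⟨f, C, hinj, hadj, hCA, hCcard, hlink⟩ := ih
      have hScard : S.card ≤ Fintype.card W := Finset.card_le_univ S
      have hClarge : ∀ w, ρ ^ Fintype.card W * (A (c w)).card ≤ (C w).card := fun w =>
        (mul_le_mul_of_nonneg_right (pow_le_pow_of_le_one hρ.le hρ₁ hScard)
          (by positivity)).trans (hCcard w)
      have hCδ : ∀ w, δ * (A (c w)).card ≤ (C w).card := fun w =>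
        (mul_le_mul_of_nonneg_right hδρ (by positivity)).trans (hClarge w)
      -- One relation covers an arc out of `s`, an arc into `s` and no arc; in the last case it is
      -- vacuous.
      obtain ⟨R, hRdef⟩ : ∃ R : W → V → V → Prop, ∀ w v y, R w v y ↔
          (H.Adj s w → D.Adj v y) ∧ (H.Adj w s → D.Adj y v) := ⟨_, fun _ _ _ => Iff.rfl⟩
      obtain ⟨Bad, hBadDef⟩ : ∃ Bad : W → Finset V, ∀ w, Bad w = (C s).filter fun v =>
          (((C w).filter fun y => R w v y).card : ℝ) < ρ * (C w).card := ⟨_, fun _ => rfl⟩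
      have hBad : ∀ w, ((Bad w).card : ℝ) < δ * (A (c s)).card := by
        intro w
        have hpos : 0 < δ * ((A (c s)).card : ℝ) := mul_pos hδ (hApos _)
        rw [hBadDef]
        refine card_lowDegree_lt hpos fun Z hZ hZc => ?_
        have hZA := hZ.trans (hCA s)
        by_cases h1 : H.Adj s w
        · have h2 := hH _ _ h1
          have hR : ∀ v y, R w v y ↔ D.Adj v y := fun v y => by simp [hRdef, h1, h2]
          have hcard : ((Z ×ˢ C w).filter fun p => R w p.1 p.2).card =
              arcsBetween D Z (C w) :=
            congrArg Finset.card (Finset.filter_congr fun p _ => hR p.1 p.2)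
          rw [hcard]
          exact hdense _ _ (hc _ _ h1) Z hZA (C w) (hCA w) hZc (hCδ w)
        · by_cases h2 : H.Adj w s
          · have hR : ∀ v y, R w v y ↔ D.Adj y v := fun v y => by simp [hRdef, h1, h2]
            have hcard : ((Z ×ˢ C w).filter fun p => R w p.1 p.2).card =
                arcsBetween D (C w) Z :=
              (congrArg Finset.card (Finset.filter_congr fun p _ => hR p.1 p.2)).trans
                (card_reverse D Z (C w))
            rw [hcard, mul_comm (Z.card : ℝ)]
            exact hdense _ _ (hc _ _ h2) (C w) (hCA w) Z hZA (hCδ w) hZc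
          · have hR : ∀ v y, R w v y := fun v y => by simp [hRdef, h1, h2]
            rw [Finset.filter_true_of_mem fun p _ => hR p.1 p.2, Finset.card_product,
              Nat.cast_mul]
            exact mul_le_of_le_one_left (by positivity) hρ₁
      -- Each `w` spoils fewer than `δ |A (c s)|` choices and at most `|W|` vertices are used, so
      -- `hsize` leaves a good one.
      have hex : ∃ v ∈ C s, v ∉ S.image f ∪ Finset.univ.biUnion Bad := by
        by_contra! hcon
        have h1 : (C s).card ≤ S.card + ∑ w, (Bad w).card :=
          (Finset.card_le_card hcon).trans ((Finset.card_union_le _ _).trans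
            (add_le_add Finset.card_image_le Finset.card_biUnion_le))
        have h2 : ((C s).card : ℝ) ≤ S.card + ∑ w, ((Bad w).card : ℝ) := by exact_mod_cast h1
        have h3 : (∑ w, ((Bad w).card : ℝ)) ≤ Fintype.card W * (δ * (A (c s)).card) := by
          have := Finset.sum_le_card_nsmul Finset.univ _ _ fun w _ => (hBad w).le
          rwa [nsmul_eq_mul, Finset.card_univ] at this
        have h4 : (S.card : ℝ) ≤ Fintype.card W := by exact_mod_cast hScard
        have := hsize (c s)
        have := hClarge s
        linarith
      obtain ⟨v, hvC, hv⟩ := hex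
      simp only [Finset.mem_union, Finset.mem_image, Finset.mem_biUnion, Finset.mem_univ,
        true_and, not_or, not_exists, not_and] at hv
      obtain ⟨hvf, hvB⟩ := hv
      have hne : ∀ x ∈ S, x ≠ s := fun x hx h => hs (h ▸ hx)
      have hfx : ∀ x ∈ S, Function.update f s v x = f x := fun x hx =>
        Function.update_of_ne (hne x hx) _ _
      have hss : ¬ H.Adj s s := fun h => hH _ _ h h
      refine ⟨Function.update f s v, fun w => (C w).filter fun y => R w v y, ?_, ?_, ?_, ?_, ?_⟩
      · rw [Finset.coe_insert, Set.injOn_insert (by simpa using hs)]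
        refine ⟨fun x hx y hy h => hinj hx hy ?_, ?_⟩
        · rwa [hfx x hx, hfx y hy] at h
        · rintro ⟨x, hx, h⟩
          rw [hfx x hx, Function.update_self] at h
          exact hvf x hx h
      · intro x hx y hy hxy
        rcases Finset.mem_insert.mp hx with rfl | hxS
        · rcases Finset.mem_insert.mp hy with rfl | hyS
          · exact absurd hxy hss
          · rw [Function.update_self, hfx y hyS]
            exact (hlink x hs v hvC y hyS).2 hxy
        · rcases Finset.mem_insert.mp hy with rfl | hyS
          · rw [Function.update_self, hfx x hxS]
            exact (hlink y hs v hvC x hxS).1 hxy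
          · rw [hfx x hxS, hfx y hyS]
            exact hadj x hxS y hyS hxy
      · exact fun w => (Finset.filter_subset _ _).trans (hCA w)
      · intro w
        have h1 : ρ * (C w).card ≤ ((C w).filter fun y => R w v y).card := by
          by_contra! h
          exact hvB w (hBadDef w ▸ Finset.mem_filter.mpr ⟨hvC, h⟩)
        rw [Finset.card_insert_of_notMem hs, pow_succ', mul_assoc]
        exact (mul_le_mul_of_nonneg_left (hCcard w) hρ.le).trans h1
      · intro w hw y hy x hx
        have hwS : w ∉ S := fun h => hw (Finset.mem_insert_of_mem h)
        obtain ⟨hyC, hyR⟩ := Finset.mem_filter.mp hy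
        rcases Finset.mem_insert.mp hx with rfl | hxS
        · rw [Function.update_self]
          exact (hRdef _ _ _).mp hyR
        · rw [hfx x hxS]
          exact hlink w hwS y hyC x hxS
  obtain ⟨f, -, hinj, hadj, -⟩ := key Finset.univ
  exact ⟨⟨f, fun x y h => hinj (by simp) (by simp) h⟩,
    fun x y => hadj x (Finset.mem_univ _) y (Finset.mem_univ _)⟩

end Embedding

/-! ### From small bias to density in both directions -/

open Classical in
lemma mul_lt_arcsBetween_of_bias_lt {V : Type*} [Fintype V] {D : Digraph V} {ν : ℝ}
    {A B : Finset V} (h : bias ν D < arcsBetween D A B) :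
    ν * arcsBetween D A B < arcsBetween D B A := by
  by_contra! hcon
  refine h.not_ge ?_
  unfold bias
  exact Finset.le_sup (f := fun P : Finset V × Finset V => arcsBetween D P.1 P.2) (b := (A, B))
    (Finset.mem_filter.mpr ⟨Finset.mem_univ _, hcon⟩)

lemma numArcs_le_sq {V : Type*} [Fintype V] (D : Digraph V) :
    numArcs D ≤ Fintype.card V ^ 2 := by
  classical
  unfold numArcs arcsBetween
  refine (Finset.card_filter_le _ _).trans ?_
  rw [Finset.card_product, Finset.card_univ, sq]

/-- A `k`-colourable oriented graph is unavoidable under small bias at every edge density for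
which the union bound yields a positive density of `k`-cliques. -/
theorem containsCopy_of_coloring {W : Type u} [Fintype W] {H : Digraph W} (hH : IsOriented H)
    {k : ℕ} (c : W → Fin k) (hc : ∀ x y, H.Adj x y → c x ≠ c y) {β : ℝ} (hβ : β < 1 / 2)
    (hβk : k.choose 2 * (1 - 2 * β) < 1) {ν : ℝ} (hν : 0 < ν) (hν₁ : ν < 1) :
    ∃ ε : ℝ, 0 < ε ∧ ∃ N : ℕ,
      ∀ (V : Type v) [Fintype V] (D : Digraph V), IsOriented D →
        N ≤ Fintype.card V → β * (Fintype.card V : ℝ) ^ 2 ≤ (numArcs D : ℝ) →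
        (bias ν D : ℝ) ≤ ε * (numArcs D : ℝ) → ContainsCopy H D := by
  set t₀ : ℝ := 1 - k.choose 2 * (1 - 2 * β) with ht₀_def
  have ht₀ : 0 < t₀ := by linarith
  have ht₁ : t₀ ≤ 1 := by
    have : 0 ≤ (k.choose 2 : ℝ) * (1 - 2 * β) := mul_nonneg (by positivity) (by linarith)
    linarith
  set h : ℕ := Fintype.card W with hh
  -- `t₀ / 4` is the density of the richer direction, and `ν` is the loss in passing to the opposite
  -- one.
  set ρ : ℝ := ν * (t₀ / 4) with hρ_def
  have hρ : 0 < ρ := by positivity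
  have hρ₁ : ρ ≤ 1 := by nlinarith
  have hρ4 : ρ ≤ t₀ / 4 := mul_le_of_le_one_left (by positivity) hν₁.le
  -- Then `ρ ^ h = (h + 1) δ`, so the size condition of the embedding reduces to `h < δ |A i|`,
  -- which `N` ensures.
  set δ : ℝ := ρ ^ h / (h + 1) with hδ_def
  have hδ : 0 < δ := by positivity
  have hδρ : δ ≤ ρ ^ h := div_le_self (by positivity)
    (by linarith [(Nat.cast_nonneg h : (0 : ℝ) ≤ h)])
  have hδ₁ : δ ≤ 1 := hδρ.trans (pow_le_one₀ hρ.le hρ₁)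
  obtain ⟨a, ha, hreg⟩ := exists_isLowerRegular.{v} (Fin k) ht₀ ht₁ hδ hδ₁
  obtain ⟨N, hN⟩ := exists_nat_gt (h / (δ * a))
  -- Large subsets have at least `δ a n` elements, so this `ε` keeps the bias below `t₀ / 4 * (|X|
  -- |Y|)`.
  refine ⟨t₀ / 8 * (δ * a) ^ 2, by positivity, N + 1, fun V _ D hD hcard harcs hbias => ?_⟩
  have hnpos : 0 < Fintype.card V := by omega
  have hVne : Nonempty V := Fintype.card_pos_iff.mp hnpos
  set n : ℝ := (Fintype.card V : ℝ) with hn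
  have hnR : 0 < n := by rw [hn]; exact_mod_cast hnpos
  obtain ⟨A, hA, hAreg⟩ := hreg V (Linked D) (by
    rw [Fintype.card_fin]; exact le_boxCount_linked hD k harcs)
  have hbias' : (bias ν D : ℝ) ≤ t₀ / 8 * (δ * a * n) ^ 2 := by
    have h1 : (numArcs D : ℝ) ≤ n ^ 2 := by rw [hn]; exact_mod_cast numArcs_le_sq D
    calc _ ≤ _ := hbias
      _ ≤ t₀ / 8 * (δ * a) ^ 2 * n ^ 2 := mul_le_mul_of_nonneg_left h1 (by positivity)
      _ = _ := by ring
  refine containsCopy_of_dense hH c hc A hρ hρ₁ hδ (fun i => ?_) hδρ ?_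
  · have h1 : (h : ℝ) < δ * (A i).card := by
      have h2 : (N : ℝ) < n := by rw [hn]; exact_mod_cast hcard
      rw [div_lt_iff₀ (by positivity)] at hN
      calc (h : ℝ) < N * (δ * a) := hN
        _ ≤ n * (δ * a) := mul_le_mul_of_nonneg_right h2.le (by positivity)
        _ = δ * (a * n) := by ring
        _ ≤ _ := mul_le_mul_of_nonneg_left (hA i) hδ.le
    have h3 : ρ ^ h = (h + 1) * δ := by rw [hδ_def]; field_simp
    rw [h3]
    linarith
  · intro i j hij X hX Y hY hXc hYc
    have hlink := hAreg i j hij X hX Y hY hXc hYc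
    have hsum : ((open Classical in
        ((X ×ˢ Y).filter fun p => Linked D p.1 p.2).card : ℕ) : ℝ) ≤
        arcsBetween D X Y + arcsBetween D Y X := by
      exact_mod_cast card_linked_le D X Y
    have hXn : δ * a * n ≤ X.card := by
      rw [mul_assoc]; exact (mul_le_mul_of_nonneg_left (hA i) hδ.le).trans hXc
    have hYn : δ * a * n ≤ Y.card := by
      rw [mul_assoc]; exact (mul_le_mul_of_nonneg_left (hA j) hδ.le).trans hYc
    have hprod : (δ * a * n) ^ 2 ≤ (X.card : ℝ) * Y.card := by
      rw [sq]; exact mul_le_mul hXn hYn (by positivity) (by positivity)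
    have hsq : 0 < (δ * a * n) ^ 2 := by positivity
    have hXY : (0 : ℝ) < (X.card : ℝ) * Y.card := hsq.trans_le hprod
    by_cases hle : t₀ / 4 * ((X.card : ℝ) * Y.card) ≤ arcsBetween D X Y
    · exact (mul_le_mul_of_nonneg_right hρ4 hXY.le).trans hle
    · have hYX : t₀ / 4 * ((X.card : ℝ) * Y.card) ≤ arcsBetween D Y X := by linarith
      have hlt : bias ν D < arcsBetween D Y X := by
        have : (bias ν D : ℝ) < arcsBetween D Y X := by nlinarith
        exact_mod_cast this
      have h1 := mul_lt_arcsBetween_of_bias_lt hlt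
      calc _ = ν * (t₀ / 4 * ((X.card : ℝ) * Y.card)) := by rw [hρ_def]; ring
        _ ≤ ν * arcsBetween D Y X := mul_le_mul_of_nonneg_left hYX hν.le
        _ ≤ _ := h1.le

end OrientedBias

/-! ### Choice of the colouring and of `β` -/

theorem mainTheorem12 {W : Type u} [Fintype W] (H : Digraph W)
    (hH : OrientedBias.IsOriented H) :
    (∃ β : ℝ, 0 < β ∧ β < 1 / 2 ∧
      ∀ ν : ℝ, 0 < ν → ν < 1 →
        ∃ ε : ℝ, 0 < ε ∧ ∃ N : ℕ,
          ∀ (V : Type v) [Fintype V] (D : Digraph V), OrientedBias.IsOriented D →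
            N ≤ Fintype.card V →
            β * (Fintype.card V : ℝ) ^ 2 ≤ (OrientedBias.numArcs D : ℝ) →
            (OrientedBias.bias ν D : ℝ) ≤ ε * (OrientedBias.numArcs D : ℝ) →
            OrientedBias.ContainsCopy H D) ∧
    (H.toSimpleGraphInclusive.IsBipartite →
      ∀ β : ℝ, 0 < β → β < 1 / 2 →
      ∀ ν : ℝ, 0 < ν → ν < 1 →
        ∃ ε : ℝ, 0 < ε ∧ ∃ N : ℕ,
          ∀ (V : Type v) [Fintype V] (D : Digraph V), OrientedBias.IsOriented D →
            N ≤ Fintype.card V →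
            β * (Fintype.card V : ℝ) ^ 2 ≤ (OrientedBias.numArcs D : ℝ) →
            (OrientedBias.bias ν D : ℝ) ≤ ε * (OrientedBias.numArcs D : ℝ) →
            OrientedBias.ContainsCopy H D) := by
  have hirr : ∀ x y, H.Adj x y → x ≠ y := by
    rintro x _ hxy rfl
    exact hH x x hxy hxy
  refine ⟨?_, fun hbip β hβ hβ' ν hν hν₁ => ?_⟩
  · set h : ℕ := Fintype.card W with hh
    -- `q` stands for `1 - 2β` and must satisfy `h.choose 2 * q < 1`; the `+ 2` also keeps `q < 1`,
    -- hence `β > 0`, when `h ≤ 1`.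
    set q : ℝ := 1 / (h.choose 2 + 2) with hq
    have hden : (0 : ℝ) < h.choose 2 + 2 := by positivity
    have hq0 : 0 < q := by positivity
    have hq1 : q < 1 := by
      rw [hq, div_lt_one hden]
      have : (0 : ℝ) ≤ h.choose 2 := by positivity
      linarith
    refine ⟨(1 - q) / 2, by linarith, by linarith, fun ν hν hν₁ => ?_⟩
    refine OrientedBias.containsCopy_of_coloring hH (Fintype.equivFin W)
      (fun x y hxy => (Fintype.equivFin W).injective.ne (hirr x y hxy)) (by linarith) ?_ hν hν₁
    have : (1 : ℝ) - 2 * ((1 - q) / 2) = q := by ring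
    rw [this, hq, mul_one_div, div_lt_one hden]
    linarith
  -- For two colours the clique condition is just `1 - 2β < 1`.
  · obtain ⟨c⟩ := hbip
    refine OrientedBias.containsCopy_of_coloring hH c (fun x y hxy => c.valid ?_) hβ' ?_ hν hν₁
    · exact ⟨hirr x y hxy, Or.inl hxy⟩
    · simp only [Nat.choose_self, Nat.cast_one, one_mul]
      linarith
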